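/- Let $\lambda>0$ and $u\in(0,1)$, let $X_1,X_2,\ldots$ be i.i.d. $\mathrm{Exp}(\lambda)$ random variables (density $\lambda e^{-\lambda x}$, $x>0$), and let $f_u(x)=1-u^x$. Consider the estimator $$\hat\lambda_n=\frac{\frac1n\sum_{i=1}^n f_u'(X_i)}{\frac1n\sum_{i=1}^n f_u(X_i)},$$ and, for $n\ge1$, put $$\sigma_n^2=\frac{\lambda}{n}\,\frac{(\lambda-\ln u)^2}{\lambda-2\ln u},\qquad B_n=\frac{\sigma_n^2}{\lambda-\ln u},\qquad \mathrm{MSE}_n=\Big(1+\frac{\lambda}{n(\lambda-2\ln u)}\Big)\sigma_n^2 .$$ Then: 1. $\hat\lambda_n$ is asymptotically normal with asymptotic variance $\sigma_n^2$: $\sqrt n\,(\hat\lambda_n-\lambda)$ converges in distribution to $N(0,v)$, where $v=n\sigma_n^2>0$ does not depend on $n$. 2. $\hat\lambda_n$ has asymptotic bias $B_n$: for all large $n$ the expectation $E[\hat\lambda_n]$ is finite, and $E[\hat\lambda_n]-\lambda=B_n+o(1/n)$. Moreover, for every $n\ge1$, $B_n$ is exactly the expectation of the second-order Taylor approximation of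 $\hat\lambda_n-\lambda$, that is, of the sum of the first- and second-order Taylor terms of $g(a,b)=a/b$ at $\big(E[f_u'(X_1)],E[f_u(X_1)]\big)$, evaluated at $\big(\frac1n\sum_i f_u'(X_i),\frac1n\sum_i f_u(X_i)\big)$; this approximation is integrable. 3. The asymptotic mean squared error is $\sigma_n^2+B_n^2=\mathrm{MSE}_n$ for every $n\ge1$; for all large $n$ the second moment of $\hat\lambda_n$ is finite, and $E[(\hat\lambda_n-\lambda)^2]=\mathrm{MSE}_n+o(1/n)$. -/

import Mathlib

open MeasureTheory ProbabilityTheory Filter Topology Asymptotics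
open scoped NNReal

noncomputable section

namespace SteinMM

variable {Ω : Type*} [MeasurableSpace Ω]

/-- The sample moment `(1/n) ∑ h(Xᵢ)` of the first `n` observations. -/
def sampleMean (h : ℝ → ℝ) (X : ℕ → Ω → ℝ) (n : ℕ) (ω : Ω) : ℝ :=
  (∑ i ∈ Finset.range n, h (X i ω)) / n

/-- The Stein-MM estimator of the rate of an exponential distribution with weighting function `f`:
the sample mean of `f'(Xᵢ)` divided by the sample mean of `f(Xᵢ)`. -/
def expEstimator (f : ℝ → ℝ) (X : ℕ → Ω → ℝ) (n : ℕ) (ω : Ω) : ℝ :=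
  sampleMean (deriv f) X n ω / sampleMean f X n ω

/-- The weighting function `f_u(x) = 1 - u ^ x`. -/
def weightU (u : ℝ) (x : ℝ) : ℝ := 1 - u ^ x

/-- `T n` is an asymptotically normal estimator of `θ` with asymptotic variance `s n`:
`√n (T n - θ)` converges in distribution to a nondegenerate `N(0, v)`, and `s n = v / n`. -/
def IsAsympNormal (P : Measure Ω) [IsProbabilityMeasure P]
    (T : ℕ → Ω → ℝ) (θ : ℝ) (s : ℕ → ℝ) : Prop :=
  ∃ v : ℝ≥0, 0 < v ∧ (∀ n : ℕ, 1 ≤ n → s n = v / n) ∧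
    TendstoInDistribution (fun (n : ℕ) ω => √(n : ℝ) * (T n ω - θ)) atTop
      (id : ℝ → ℝ) (fun _ => P) (gaussianReal 0 v)

/-- `b n` is the leading term of the bias: `E[T n] - θ = b n + o(1/n)`, the expectation being
finite for all large `n`. -/
def HasAsympBias (P : Measure Ω) (T : ℕ → Ω → ℝ) (θ : ℝ) (b : ℕ → ℝ) : Prop :=
  (∀ᶠ n in atTop, Integrable (T n) P) ∧
    (fun n : ℕ => ((∫ ω, T n ω ∂P) - θ) - b n) =o[atTop] (fun n : ℕ => 1 / (n : ℝ))

/-- `m n` approximates the mean squared error to first order: `E[(T n - θ)²] = m n + o(1/n)`,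
the second moment being finite for all large `n`. -/
def HasAsympMSE (P : Measure Ω) (T : ℕ → Ω → ℝ) (θ : ℝ) (m : ℕ → ℝ) : Prop :=
  (∀ᶠ n in atTop, MemLp (T n) 2 P) ∧
    (fun n : ℕ => (∫ ω, (T n ω - θ) ^ 2 ∂P) - m n) =o[atTop] (fun n : ℕ => 1 / (n : ℝ))

/-- The first- plus second-order terms of the Taylor expansion of `g` at `p`,
`D g(p) (z - p) + (1/2) (z - p)ᵀ H g(p) (z - p)`. -/
def taylorTwo (g : ℝ × ℝ → ℝ) (p z : ℝ × ℝ) : ℝ :=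
  fderiv ℝ g p (z - p) + (1 / 2) * fderiv ℝ (fderiv ℝ g) p (z - p) (z - p)

/-- The second-order Taylor approximation of `expEstimator f X n - lam`: the expansion of
`g(a, b) = a / b` at the mean `(E[f'(X)], E[f(X)])` under the exponential law of rate `lam`,
evaluated at the sample means of `f'` and `f`. -/
def expTaylorError (f : ℝ → ℝ) (lam : ℝ) (X : ℕ → Ω → ℝ) (n : ℕ) (ω : Ω) : ℝ :=
  taylorTwo (fun p => p.1 / p.2)
    (∫ x, deriv f x ∂(expMeasure lam), ∫ x, f x ∂(expMeasure lam))
    (sampleMean (deriv f) X n ω, sampleMean f X n ω)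

/-- The asymptotic variance `(λ/n) (λ - ln u)² / (λ - 2 ln u)`. -/
def asympVarU (lam u : ℝ) (n : ℕ) : ℝ :=
  lam / n * ((lam - Real.log u) ^ 2 / (lam - 2 * Real.log u))

/-- The asymptotic bias, the asymptotic variance divided by `λ - ln u`. -/
def asympBiasU (lam u : ℝ) (n : ℕ) : ℝ :=
  asympVarU lam u n / (lam - Real.log u)

/-- The asymptotic mean squared error `(1 + λ / (n (λ - 2 ln u)))` times the asymptotic
variance. -/
def asympMSEU (lam u : ℝ) (n : ℕ) : ℝ :=
  (1 + lam / (n * (lam - 2 * Real.log u))) * asympVarU lam u n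

end SteinMM

end

/-! Write `L = -ln u` and `V i = 1 - u ^ X i`, which lies in `(0, 1]` almost surely. Since `f_u' = L
(1 - f_u)`, the estimator is `L (W⁻¹ - 1)` with `W` the average of the `V i`, and its error is `L
(W⁻¹ - q⁻¹)` with `q = E V = L / (λ + L)`. Everything thus concerns the reciprocal of an average of
i.i.d. variables.

With `D = W - q`, the expansion `W⁻¹ = q⁻¹ - D / q² + D² / q³ + …` gives bias `L Var V / (n q³)`,
and `(W⁻¹ - q⁻¹)² ≈ D² / q⁴` gives mean squared error `L² Var V / (n q⁴)`. The explicit values of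
`q` and `Var V` turn these into `B_n` and `σ_n²`; the term `B_n²` in the MSE is `O(1/n²)`.

The difficulty is that `W` may be near `0`. Both remainders are at most a constant times `|D|³ /
W²`, whose mean is `O(n^(-3/2))` (`exists_integral_abs_cube_div_le`). This combines a sub-Gaussian
bound `E D⁴ = O(n⁻²)` with a uniform bound on `E W⁻⁸`. For the latter, AM-GM gives `W⁻⁸ ≤ ∏ (V
i)^(-8/n)`; independence and Jensen then bound the mean by `(E V^(-1/2))¹⁶`, finite because `V`
vanishes only linearly as `X` tends to `0`.

Asymptotic normality follows from the central limit theorem, the strong law and Slutsky's theorem.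
-/

lemma Real.pow_four_le_exp_add_exp (x : ℝ) :
    x ^ 4 ≤ 24 * (Real.exp x + Real.exp (-x)) := by
  rcases le_total 0 x with h | h
  · have := Real.pow_div_factorial_le_exp x h 4
    have h' := Real.exp_pos (-x)
    norm_num [Nat.factorial] at this
    linarith
  · have := Real.pow_div_factorial_le_exp (-x) (by linarith) 4
    have h' := Real.exp_pos x
    norm_num [Nat.factorial] at this
    have e : (-x) ^ 4 = x ^ 4 := by ring
    linarith

namespace SteinMM

/-! ### Positive and negative moments of averages. -/

section Averages

variable {Ω : Type*} [MeasurableSpace Ω] {P : Measure Ω} [IsProbabilityMeasure P]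
  {V : ℕ → Ω → ℝ}

/-- The average of the first `n` members of a sequence of random variables. -/
noncomputable def average (V : ℕ → Ω → ℝ) (n : ℕ) (ω : Ω) : ℝ := (∑ i ∈ Finset.range n, V i ω) / n

omit [IsProbabilityMeasure P] in
lemma aemeasurable_average (hV : ∀ i, AEMeasurable (V i) P) (n : ℕ) :
    AEMeasurable (average V n) P :=
  (Finset.aemeasurable_fun_sum _ fun i _ => hV i).div_const _

/-- The fourth central moment of the average of `n` independent `[0, 1]`-valued variables with a
common mean is `O(1 / n ^ 2)`. -/
lemma exists_integral_average_sub_pow_four_le (hind : iIndepFun V P)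
    (hV : ∀ i, AEMeasurable (V i) P) (hV01 : ∀ i, ∀ᵐ ω ∂P, V i ω ∈ Set.Icc (0 : ℝ) 1)
    {q : ℝ} (hq : ∀ i, ∫ ω, V i ω ∂P = q) :
    ∃ C : ℝ, 0 ≤ C ∧ ∀ n : ℕ, 1 ≤ n → Integrable (fun ω => (average V n ω - q) ^ 4) P ∧
      ∫ ω, (average V n ω - q) ^ 4 ∂P ≤ C / (n : ℝ) ^ 2 := by
  set c : ℝ≥0 := (‖(1 : ℝ) - 0‖₊ / 2) ^ 2 with hc
  -- Here `c = 1/4` is Hoeffding's variance proxy. At `t = ±1/√n` the mgf of the centred sum is at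
  -- most `exp (n c t² / 2) = exp (c / 2)`; two such terms times `24 = 4!` give `48`.
  refine ⟨48 * Real.exp (c / 2), by positivity, fun n hn => ?_⟩
  have hn0 : (0 : ℝ) < n := by exact_mod_cast hn
  have hsub : HasSubgaussianMGF (fun ω => ∑ i ∈ Finset.range n, (V i ω - q))
      (∑ i ∈ Finset.range n, c) P := by
    refine HasSubgaussianMGF.sum_of_iIndepFun (X := fun i ω => V i ω - q)
      (hind.comp (fun _ x => x - q) (by fun_prop)) (c := fun _ => c) fun i _ => ?_
    simpa only [hq i] using hasSubgaussianMGF_of_mem_Icc (hV i) (hV01 i)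
  set S : Ω → ℝ := fun ω => ∑ i ∈ Finset.range n, (V i ω - q) with hS
  have hSav (ω : Ω) : average V n ω - q = S ω / n := by
    simp only [average, hS, Finset.sum_sub_distrib, Finset.sum_const, Finset.card_range,
      nsmul_eq_mul]
    field_simp
  have hs : (0 : ℝ) < √n := Real.sqrt_pos.2 hn0
  have hss : √(n : ℝ) ^ 2 = n := Real.sq_sqrt hn0.le
  have hmgf (t : ℝ) (ht : t ^ 2 = 1 / n) : mgf S P t ≤ Real.exp (c / 2) := by
    refine (hsub.mgf_le t).trans_eq ?_
    rw [ht]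
    congr 1
    simp
    field_simp
  have hle (ω : Ω) : (average V n ω - q) ^ 4 ≤
      24 / (n : ℝ) ^ 2 * (Real.exp ((1 / √n) * S ω) + Real.exp ((-(1 / √n)) * S ω)) := by
    have h := Real.pow_four_le_exp_add_exp ((1 / √n) * S ω)
    have e : (average V n ω - q) ^ 4 = ((1 / √n) * S ω) ^ 4 / (n : ℝ) ^ 2 := by
      have h4 : √(n : ℝ) ^ 4 = (n : ℝ) ^ 2 := by
        rw [show √(n : ℝ) ^ 4 = (√(n : ℝ) ^ 2) ^ 2 by ring, hss]
      rw [hSav, mul_pow, div_pow, div_pow, h4]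
      field_simp
    rw [e, neg_mul, div_mul_eq_mul_div (24 : ℝ)]
    exact div_le_div_of_nonneg_right h (by positivity)
  have hint : Integrable (fun ω => 24 / (n : ℝ) ^ 2 *
      (Real.exp ((1 / √n) * S ω) + Real.exp ((-(1 / √n)) * S ω))) P :=
    ((hsub.integrable_exp_mul _).add (hsub.integrable_exp_mul _)).const_mul _
  have hi : Integrable (fun ω => (average V n ω - q) ^ 4) P := by
    refine hint.mono' (((aemeasurable_average hV n).sub_const q).pow_const 4).aestronglyMeasurable
      (ae_of_all _ fun ω => ?_)
    rw [Real.norm_of_nonneg (by positivity)]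
    exact hle ω
  refine ⟨hi, (integral_mono hi hint hle).trans ?_⟩
  rw [integral_const_mul, integral_add (hsub.integrable_exp_mul _) (hsub.integrable_exp_mul _)]
  have ht : (1 / √(n : ℝ)) ^ 2 = 1 / n := by rw [div_pow, hss, one_pow]
  have h1 := hmgf (1 / √n) ht
  have h2 := hmgf (-(1 / √n)) (by rw [neg_sq, ht])
  simp only [mgf] at h1 h2
  calc _ ≤ 24 / (n : ℝ) ^ 2 * (Real.exp (c / 2) + Real.exp (c / 2)) := by gcongr
    _ = _ := by ring

/-- If `V ^ (-1/2)` is integrable, the average of `n ≥ 16` independent copies of `V` has an inverse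
eighth moment bounded independently of `n`. -/
lemma exists_integral_inv_average_pow_le (hind : iIndepFun V P)
    (hid : ∀ i, IdentDistrib (V i) (V 0) P P)
    (hV01 : ∀ i, ∀ᵐ ω ∂P, V i ω ∈ Set.Ioc (0 : ℝ) 1)
    (hint : Integrable (fun ω => V 0 ω ^ (-(1 / 2) : ℝ)) P) :
    ∃ C : ℝ, 0 ≤ C ∧ ∀ n : ℕ, 16 ≤ n → Integrable (fun ω => (average V n ω ^ 8)⁻¹) P ∧
      ∫ ω, (average V n ω ^ 8)⁻¹ ∂P ≤ C := by
  have hV (i) : AEMeasurable (V i) P := (hid i).aemeasurable_fst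
  have hA0 : 0 ≤ ∫ ω, V 0 ω ^ (-(1 / 2) : ℝ) ∂P := by
    refine integral_nonneg_of_ae ?_
    filter_upwards [hV01 0] with ω h using Real.rpow_nonneg h.1.le _
  refine ⟨(∫ ω, V 0 ω ^ (-(1 / 2) : ℝ) ∂P) ^ 16, by positivity, fun n hn => ?_⟩
  have hn0 : (0 : ℝ) < n := by exact_mod_cast (by omega : 0 < n)
  have hn16 : (16 : ℝ) / n ≤ 1 := by
    rw [div_le_one hn0]; exact_mod_cast hn
  -- The exponent is `-8/n = (-1/2) (16/n)`. For `n ≥ 16` the outer power `16/n` is at most `1`,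
  -- hence concave, and `V ≤ 1` gives `V^(-8/n) ≤ V^(-1/2)`.
  set f : ℝ → ℝ := fun x => x ^ (-(8 / n) : ℝ) with hf
  have hfm : Measurable f := by fun_prop
  have hfeq {x : ℝ} (hx : 0 < x) : f x = (x ^ (-(1 / 2) : ℝ)) ^ ((16 : ℝ) / n) := by
    change x ^ (-(8 / n) : ℝ) = _
    rw [← Real.rpow_mul hx.le]
    congr 1
    ring
  have hfint0 : Integrable (fun ω => f (V 0 ω)) P := by
    refine (hint.const_mul 1).mono' (hfm.comp_aemeasurable (hV 0)).aestronglyMeasurable ?_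
    filter_upwards [hV01 0] with ω h
    rw [hf, Real.norm_of_nonneg (Real.rpow_nonneg h.1.le _), one_mul]
    refine Real.rpow_le_rpow_of_exponent_ge h.1 h.2 ?_
    have : (8 : ℝ) / n = 16 / n / 2 := by ring
    linarith
  have hfint (i) : Integrable (fun ω => f (V i ω)) P :=
    ((hid i).comp hfm).integrable_iff.2 hfint0
  have hfV (i) : ∫ ω, f (V i ω) ∂P = ∫ ω, f (V 0 ω) ∂P := ((hid i).comp hfm).integral_eq
  have hJ : ∫ ω, f (V 0 ω) ∂P ≤ (∫ ω, V 0 ω ^ (-(1 / 2) : ℝ) ∂P) ^ ((16 : ℝ) / n) := by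
    have hae : (fun ω => f (V 0 ω)) =ᵐ[P]
        fun ω => (V 0 ω ^ (-(1 / 2) : ℝ)) ^ ((16 : ℝ) / n) := by
      filter_upwards [hV01 0] with ω h using hfeq h.1
    rw [integral_congr_ae hae]
    -- Jensen's inequality; after the `n`-th power the exponent `16/n` becomes `16`, free of `n`.
    refine (Real.concaveOn_rpow (by positivity) hn16).le_map_integral
      (Real.continuous_rpow_const (by positivity)).continuousOn isClosed_Ici ?_ hint
      (hfint0.congr hae)
    filter_upwards [hV01 0] with ω h using Real.rpow_nonneg h.1.le _
  have hind' : iIndepFun (fun (i : Fin n) => V i) P := hind.precomp Fin.val_injective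
  have hmap := hind'.map_fun_eq_pi_map fun i : Fin n => hV i
  have hprodint : Integrable (fun ω => ∏ i : Fin n, f (V i ω)) P := by
    -- By independence the joint law is a product measure, so integrability of the product reduces
    -- to that of its factors.
    have h1 : Integrable (fun x : Fin n → ℝ => ∏ i, f (x i)) (P.map fun ω (i : Fin n) => V i ω) := by
      rw [hmap]
      have (i : Fin n) : IsProbabilityMeasure (P.map (V i)) :=
        Measure.isProbabilityMeasure_map (hV i)
      exact Integrable.fintype_prod (f := fun _ => f) fun i =>
        (integrable_map_measure hfm.aestronglyMeasurable (hV i)).2 (hfint i)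
    exact h1.comp_aemeasurable (aemeasurable_pi_lambda _ fun i : Fin n => hV i)
  have hprod : ∫ ω, ∏ i : Fin n, f (V i ω) ∂P = (∫ ω, f (V 0 ω) ∂P) ^ n := by
    rw [hind'.integral_fun_prod_comp (f := fun _ => f) (fun i : Fin n => hV i)
      fun i => hfm.aestronglyMeasurable]
    simp [hfV]
  have hle : ∀ᵐ ω ∂P, (average V n ω ^ 8)⁻¹ ≤ ∏ i : Fin n, f (V i ω) := by
    filter_upwards [ae_all_iff.2 hV01] with ω h
    have hg := Real.geom_mean_le_arith_mean_weighted (Finset.range n) (fun _ => 1 / (n : ℝ))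
      (fun i => V i ω) (fun _ _ => by positivity) (by simp [hn0.ne']) (fun i _ => (h i).1.le)
    have hp : 0 < ∏ i ∈ Finset.range n, V i ω ^ (1 / (n : ℝ)) :=
      Finset.prod_pos fun i _ => Real.rpow_pos_of_pos (h i).1 _
    have hav : average V n ω = ∑ i ∈ Finset.range n, 1 / (n : ℝ) * V i ω := by
      rw [average, ← Finset.mul_sum]; ring
    rw [hav]
    calc _ ≤ ((∏ i ∈ Finset.range n, V i ω ^ (1 / (n : ℝ))) ^ 8)⁻¹ := by gcongr
      _ = ∏ i ∈ Finset.range n, f (V i ω) := by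
        rw [← Finset.prod_pow, ← Finset.prod_inv_distrib]
        refine Finset.prod_congr rfl fun i _ => ?_
        rw [hf, ← Real.rpow_natCast, ← Real.rpow_mul (h i).1.le, ← Real.rpow_neg (h i).1.le]
        congr 1
        push_cast
        ring
      _ = _ := (Fin.prod_univ_eq_prod_range (fun i => f (V i ω)) n).symm
  have hi : Integrable (fun ω => (average V n ω ^ 8)⁻¹) P := by
    refine hprodint.mono' ((aemeasurable_average hV n).pow_const 8).inv.aestronglyMeasurable ?_
    filter_upwards [hle] with ω h
    rw [Real.norm_of_nonneg (by positivity)]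
    exact h
  refine ⟨hi, (integral_mono_ae hi hprodint hle).trans ?_⟩
  have hf0 : 0 ≤ ∫ ω, f (V 0 ω) ∂P := by
    refine integral_nonneg_of_ae ?_
    filter_upwards [hV01 0] with ω h using Real.rpow_nonneg h.1.le _
  rw [hprod]
  refine (pow_le_pow_left₀ hf0 hJ n).trans_eq ?_
  rw [← Real.rpow_natCast, ← Real.rpow_mul hA0, div_mul_cancel₀ _ hn0.ne']
  exact_mod_cast rfl

/-- Two applications of AM-GM, first to `|D|³ W⁻² = D² · (|D| W⁻²)` and then to `D² W⁻⁴`. They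
separate the powers of `D` from those of `W`, so no joint moment is needed; `t` is a weight to be
optimised. -/
lemma abs_cube_div_sq_le {D W t : ℝ} (ht : 0 < t) :
    |D| ^ 3 / W ^ 2 ≤ t * D ^ 4 / 2 + (t ^ 2 * D ^ 4 + (W ^ 8)⁻¹ / t ^ 2) / (4 * t) := by
  set a := |D| with ha
  have hD : D ^ 4 = a ^ 4 := by rw [ha, ← abs_pow, abs_of_nonneg (by positivity)]
  rw [hD]
  set w := (W ^ 2)⁻¹ with hw
  have h8 : (W ^ 8)⁻¹ = w ^ 4 := by rw [hw, inv_pow, ← pow_mul]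
  rw [h8, div_eq_mul_inv]
  have h1 : a ^ 3 * w ≤ t * a ^ 4 / 2 + a ^ 2 * w ^ 2 / (2 * t) := by
    have : t * a ^ 4 / 2 + a ^ 2 * w ^ 2 / (2 * t) - a ^ 3 * w =
        (t * a ^ 2 - a * w) ^ 2 / (2 * t) := by field_simp; ring
    have : 0 ≤ (t * a ^ 2 - a * w) ^ 2 / (2 * t) := by positivity
    linarith
  have h2 : a ^ 2 * w ^ 2 ≤ (t ^ 2 * a ^ 4 + w ^ 4 / t ^ 2) / 2 := by
    have : (t ^ 2 * a ^ 4 + w ^ 4 / t ^ 2) / 2 - a ^ 2 * w ^ 2 =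
        (t * a ^ 2 - w ^ 2 / t) ^ 2 / 2 := by field_simp; ring
    have : 0 ≤ (t * a ^ 2 - w ^ 2 / t) ^ 2 / 2 := by positivity
    linarith
  calc _ ≤ t * a ^ 4 / 2 + a ^ 2 * w ^ 2 / (2 * t) := h1
    _ ≤ t * a ^ 4 / 2 + ((t ^ 2 * a ^ 4 + w ^ 4 / t ^ 2) / 2) / (2 * t) := by gcongr
    _ = _ := by ring

/-- Taking `t = √n` balances `E D⁴ = O(n⁻²)` against `E W⁻⁸ = O(1)`: every term becomes of order
`n^(-3/2)`. -/
lemma exists_integral_abs_cube_div_le (hind : iIndepFun V P)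
    (hid : ∀ i, IdentDistrib (V i) (V 0) P P)
    (hV01 : ∀ i, ∀ᵐ ω ∂P, V i ω ∈ Set.Ioc (0 : ℝ) 1)
    (hint : Integrable (fun ω => V 0 ω ^ (-(1 / 2) : ℝ)) P) {q : ℝ} (hq : ∫ ω, V 0 ω ∂P = q) :
    ∃ C : ℝ, ∀ n : ℕ, 16 ≤ n →
      Integrable (fun ω => |average V n ω - q| ^ 3 / average V n ω ^ 2) P ∧
      ∫ ω, |average V n ω - q| ^ 3 / average V n ω ^ 2 ∂P ≤ C / (n * √n) := by
  have hV (i) : AEMeasurable (V i) P := (hid i).aemeasurable_fst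
  obtain ⟨C₁, hC₁, h₁⟩ := exists_integral_average_sub_pow_four_le hind hV
    (fun i => (hV01 i).mono fun _ h => ⟨h.1.le, h.2⟩)
    (fun i => ((hid i).integral_eq).trans hq)
  obtain ⟨C₂, hC₂, h₂⟩ := exists_integral_inv_average_pow_le hind hid hV01 hint
  refine ⟨C₁ / 2 + (C₁ + C₂) / 4, fun n hn => ?_⟩
  have hn0 : (0 : ℝ) < n := by exact_mod_cast (by omega : 0 < n)
  obtain ⟨i₁, b₁⟩ := h₁ n (by omega)
  obtain ⟨i₂, b₂⟩ := h₂ n hn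
  have hs : (0 : ℝ) < √n := Real.sqrt_pos.2 hn0
  have hss : √(n : ℝ) ^ 2 = n := Real.sq_sqrt hn0.le
  have hle (ω : Ω) := abs_cube_div_sq_le (D := average V n ω - q) (W := average V n ω) hs
  have hA := (i₁.const_mul √n).div_const 2
  have hB : Integrable (fun ω => (√n ^ 2 * (average V n ω - q) ^ 4 +
      (average V n ω ^ 8)⁻¹ / √n ^ 2) / (4 * √n)) P :=
    ((i₁.const_mul (√n ^ 2)).add (i₂.div_const (√n ^ 2))).div_const (4 * √n)
  have hi : Integrable (fun ω => |average V n ω - q| ^ 3 / average V n ω ^ 2) P := by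
    have hm := aemeasurable_average hV n
    have hm' : AEMeasurable (fun ω => |average V n ω - q| ^ 3 / average V n ω ^ 2) P := by
      fun_prop
    refine (hA.add hB).mono' hm'.aestronglyMeasurable (ae_of_all _ fun ω => ?_)
    rw [Real.norm_of_nonneg (by positivity)]
    exact hle ω
  refine ⟨hi, (integral_mono hi (hA.add hB) hle).trans ?_⟩
  have e : ∫ ω, (√n * (average V n ω - q) ^ 4 / 2 +
      (√n ^ 2 * (average V n ω - q) ^ 4 + (average V n ω ^ 8)⁻¹ / √n ^ 2) / (4 * √n)) ∂P =
      √n * (∫ ω, (average V n ω - q) ^ 4 ∂P) / 2 +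
      (√n ^ 2 * (∫ ω, (average V n ω - q) ^ 4 ∂P) +
        (∫ ω, (average V n ω ^ 8)⁻¹ ∂P) / √n ^ 2) / (4 * √n) := by
    rw [integral_add hA hB, integral_div, integral_const_mul, integral_div,
      integral_add (i₁.const_mul _) (i₂.div_const _), integral_const_mul, integral_div]
  refine (le_of_eq e).trans ?_
  calc _ ≤ √n * (C₁ / (n : ℝ) ^ 2) / 2 + (√n ^ 2 * (C₁ / (n : ℝ) ^ 2) + C₂ / √n ^ 2) / (4 * √n) := by
        gcongr
    _ = _ := by
        rw [hss]
        field_simp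
        rw [hss]
        ring

end Averages

/-! ### Taylor remainders of the reciprocal. -/

lemma isLittleO_one_div_of_abs_le {g : ℕ → ℝ} {C : ℝ}
    (h : ∀ᶠ n : ℕ in atTop, |g n| ≤ C / (n * √n)) :
    g =o[atTop] (fun n : ℕ => 1 / (n : ℝ)) := by
  have h1 : g =O[atTop] fun n : ℕ => 1 / (n : ℝ) * (1 / √n) := by
    refine IsBigO.of_bound C (h.mono fun n hn => ?_)
    rw [Real.norm_eq_abs, Real.norm_of_nonneg (by positivity)]
    refine hn.trans_eq ?_
    rw [one_div_mul_one_div, mul_one_div]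
  refine h1.trans_isLittleO ?_
  have h2 : (fun n : ℕ => 1 / √(n : ℝ)) =o[atTop] (fun _ => (1 : ℝ)) := by
    rw [isLittleO_one_iff]
    exact tendsto_const_nhds.div_atTop (Real.tendsto_sqrt_atTop.comp tendsto_natCast_atTop_atTop)
  simpa using (isBigO_refl (fun n : ℕ => 1 / (n : ℝ)) atTop).mul_isLittleO h2

/-- The remainder is exactly `-(W - q)³ / (q³ W)`. Since `W ≤ 1`, its denominator `W` may be
weakened to `W²`, the form shared with the squared error. -/
lemma abs_inv_sub_taylor_le {W q : ℝ} (hW : W ∈ Set.Ioc (0 : ℝ) 1) (hq : 0 < q) :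
    |W⁻¹ - (q⁻¹ - (W - q) / q ^ 2 + (W - q) ^ 2 / q ^ 3)| ≤
      (1 / q ^ 3) * (|W - q| ^ 3 / W ^ 2) := by
  obtain ⟨h0, h1⟩ := hW
  have e : W⁻¹ - (q⁻¹ - (W - q) / q ^ 2 + (W - q) ^ 2 / q ^ 3) =
      -((1 / q ^ 3) * ((W - q) ^ 3 / W)) := by
    field_simp
    ring
  rw [e, abs_neg, abs_mul, abs_div ((W - q) ^ 3), abs_pow, abs_of_pos h0,
    abs_of_pos (by positivity : 0 < 1 / q ^ 3)]
  gcongr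
  nlinarith

/-- The difference is exactly `-(q + W) (W - q)³ / (q⁴ W²)`, and `q + W ≤ 2`. -/
lemma abs_inv_sub_inv_sq_sub_le {W q : ℝ} (hW : W ∈ Set.Ioc (0 : ℝ) 1) (hq : 0 < q)
    (hq1 : q ≤ 1) :
    |(W⁻¹ - q⁻¹) ^ 2 - (W - q) ^ 2 / q ^ 4| ≤ (2 / q ^ 4) * (|W - q| ^ 3 / W ^ 2) := by
  obtain ⟨h0, h1⟩ := hW
  have e : (W⁻¹ - q⁻¹) ^ 2 - (W - q) ^ 2 / q ^ 4 =
      -(((q + W) / q ^ 4) * ((W - q) ^ 3 / W ^ 2)) := by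
    field_simp
    ring
  rw [e, abs_neg, abs_mul, abs_div ((W - q) ^ 3), abs_pow, abs_of_pos (by positivity : 0 < W ^ 2),
    abs_of_pos (by positivity)]
  gcongr
  linarith

/-! ### Bias, mean squared error and limit law of the reciprocal of an average. -/

section Averages

variable {Ω : Type*} [MeasurableSpace Ω] {P : Measure Ω}
  {V : ℕ → Ω → ℝ} {q : ℝ}

omit [MeasurableSpace Ω] in
lemma average_mem_Ioc {v : ℕ → Ω → ℝ} {ω : Ω} (h : ∀ i, v i ω ∈ Set.Ioc (0 : ℝ) 1) {n : ℕ}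
    (hn : 1 ≤ n) : average v n ω ∈ Set.Ioc (0 : ℝ) 1 := by
  have hn0 : (0 : ℝ) < n := by exact_mod_cast hn
  refine ⟨div_pos (Finset.sum_pos (fun i _ => (h i).1) ⟨0, by simp; omega⟩) hn0, ?_⟩
  rw [average, div_le_one hn0]
  simpa using Finset.sum_le_card_nsmul (Finset.range n) (fun i => v i ω) 1 fun i _ => (h i).2

lemma ae_average_mem_Ioc (hV01 : ∀ i, ∀ᵐ ω ∂P, V i ω ∈ Set.Ioc (0 : ℝ) 1) {n : ℕ} (hn : 1 ≤ n) :
    ∀ᵐ ω ∂P, average V n ω ∈ Set.Ioc (0 : ℝ) 1 := by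
  filter_upwards [ae_all_iff.2 hV01] with ω h using average_mem_Ioc h hn

variable [IsProbabilityMeasure P]

lemma memLp_of_ae_mem_Ioc {Y : Ω → ℝ} (hY : AEMeasurable Y P)
    (h : ∀ᵐ ω ∂P, Y ω ∈ Set.Ioc (0 : ℝ) 1) (p : ENNReal) : MemLp Y p P :=
  MemLp.of_bound hY.aestronglyMeasurable 1 <| h.mono fun ω hω => by
    rw [Real.norm_of_nonneg hω.1.le]; exact hω.2

omit [IsProbabilityMeasure P] in
lemma integral_average (hid : ∀ i, IdentDistrib (V i) (V 0) P P)
    (hint : Integrable (V 0) P) (hq : ∫ ω, V 0 ω ∂P = q) {n : ℕ} (hn : 1 ≤ n) :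
    ∫ ω, average V n ω ∂P = q := by
  have hn0 : (0 : ℝ) < n := by exact_mod_cast hn
  simp only [average]
  rw [integral_div, integral_finsetSum _ fun i _ => (hid i).integrable_iff.2 hint]
  simp [(hid _).integral_eq, hq, hn0.ne']

lemma integral_average_sub_sq (hind : iIndepFun V P) (hid : ∀ i, IdentDistrib (V i) (V 0) P P)
    (hint : MemLp (V 0) 2 P) (hq : ∫ ω, V 0 ω ∂P = q) {n : ℕ} (hn : 1 ≤ n) :
    ∫ ω, (average V n ω - q) ^ 2 ∂P = Var[V 0; P] / n := by
  have hn0 : (0 : ℝ) < n := by exact_mod_cast hn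
  have hV (i) : AEMeasurable (V i) P := (hid i).aemeasurable_fst
  have h1 : Var[average V n; P] = ∫ ω, (average V n ω - q) ^ 2 ∂P := by
    rw [variance_eq_integral (aemeasurable_average hV n),
      integral_average hid (hint.integrable (by norm_num)) hq hn]
  have h2 : average V n = fun ω => (1 / (n : ℝ)) * (∑ i ∈ Finset.range n, V i) ω := by
    ext ω; simp [average]; ring
  rw [← h1, h2, variance_const_mul, IndepFun.variance_sum (fun i _ => (hid i).memLp_iff.2 hint)
    fun i _ j _ hij => hind.indepFun hij]
  simp only [(hid _).variance_eq, Finset.sum_const, Finset.card_range, nsmul_eq_mul]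
  field_simp

/-- Second-order bias of the reciprocal of an average of independent variables in `(0, 1]`. -/
theorem isLittleO_integral_inv_average (hind : iIndepFun V P)
    (hid : ∀ i, IdentDistrib (V i) (V 0) P P)
    (hV01 : ∀ i, ∀ᵐ ω ∂P, V i ω ∈ Set.Ioc (0 : ℝ) 1)
    (hint : Integrable (fun ω => V 0 ω ^ (-(1 / 2) : ℝ)) P) (hq : ∫ ω, V 0 ω ∂P = q)
    (hq0 : 0 < q) :
    (∀ᶠ n : ℕ in atTop, Integrable (fun ω => (average V n ω)⁻¹) P) ∧
    (fun n : ℕ => (∫ ω, (average V n ω)⁻¹ ∂P) - q⁻¹ - Var[V 0; P] / n / q ^ 3)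
      =o[atTop] (fun n : ℕ => 1 / (n : ℝ)) := by
  have hV (i) : AEMeasurable (V i) P := (hid i).aemeasurable_fst
  obtain ⟨C, hC⟩ := exists_integral_abs_cube_div_le hind hid hV01 hint hq
  have h0 := memLp_of_ae_mem_Ioc (hV 0) (hV01 0)
  have key : ∀ n : ℕ, 16 ≤ n → Integrable (fun ω => (average V n ω)⁻¹) P ∧
      |(∫ ω, (average V n ω)⁻¹ ∂P) - q⁻¹ - Var[V 0; P] / n / q ^ 3| ≤
        (1 / q ^ 3 * C) / (n * √n) := by
    intro n hn
    obtain ⟨hi, hb⟩ := hC n hn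
    have hm := aemeasurable_average hV n
    have hae := ae_average_mem_Ioc hV01 (by omega : 1 ≤ n)
    have hmem := memLp_of_ae_mem_Ioc hm hae
    have hD1 : Integrable (fun ω => (average V n ω - q) / q ^ 2) P :=
      (((hmem 1).integrable le_rfl).sub (integrable_const q)).div_const _
    have hD2 : Integrable (fun ω => (average V n ω - q) ^ 2 / q ^ 3) P :=
      (((hmem 2).sub (memLp_const q)).integrable_sq).div_const _
    have hQ1 : Integrable (fun ω => q⁻¹ - (average V n ω - q) / q ^ 2) P :=
      (integrable_const _).sub hD1
    have hQ : Integrable (fun ω => q⁻¹ - (average V n ω - q) / q ^ 2 +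
        (average V n ω - q) ^ 2 / q ^ 3) P := hQ1.add hD2
    have hle : ∀ᵐ ω ∂P, ‖(average V n ω)⁻¹ - (q⁻¹ - (average V n ω - q) / q ^ 2 +
        (average V n ω - q) ^ 2 / q ^ 3)‖ ≤
        1 / q ^ 3 * (|average V n ω - q| ^ 3 / average V n ω ^ 2) := by
      filter_upwards [hae] with ω h using abs_inv_sub_taylor_le h hq0
    have hR : Integrable (fun ω => (average V n ω)⁻¹ - (q⁻¹ - (average V n ω - q) / q ^ 2 +
        (average V n ω - q) ^ 2 / q ^ 3)) P :=
      (hi.const_mul _).mono' (by fun_prop) hle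
    have hI : Integrable (fun ω => (average V n ω)⁻¹) P := by
      exact (hR.add hQ).congr (ae_of_all _ fun ω => sub_add_cancel _ _)
    refine ⟨hI, ?_⟩
    have e : (∫ ω, (average V n ω)⁻¹ ∂P) - q⁻¹ - Var[V 0; P] / n / q ^ 3 =
        ∫ ω, ((average V n ω)⁻¹ - (q⁻¹ - (average V n ω - q) / q ^ 2 +
          (average V n ω - q) ^ 2 / q ^ 3)) ∂P := by
      rw [integral_sub hI hQ, integral_add hQ1 hD2, integral_sub (integrable_const _) hD1,
        integral_div, integral_div, integral_average_sub_sq hind hid (h0 2) hq (by omega),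
        integral_sub ((hmem 1).integrable le_rfl) (integrable_const q),
        integral_average hid ((h0 1).integrable le_rfl) hq (by omega)]
      simp
      ring
    rw [e]
    refine (norm_integral_le_of_norm_le (hi.const_mul _) hle).trans ?_
    rw [integral_const_mul, mul_div_assoc]
    gcongr
  exact ⟨(eventually_ge_atTop 16).mono fun n hn => (key n hn).1,
    isLittleO_one_div_of_abs_le ((eventually_ge_atTop 16).mono fun n hn => (key n hn).2)⟩

/-- Mean squared error of the reciprocal of an average of independent variables in `(0, 1]`. -/
theorem isLittleO_integral_inv_average_sub_sq (hind : iIndepFun V P)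
    (hid : ∀ i, IdentDistrib (V i) (V 0) P P)
    (hV01 : ∀ i, ∀ᵐ ω ∂P, V i ω ∈ Set.Ioc (0 : ℝ) 1)
    (hint : Integrable (fun ω => V 0 ω ^ (-(1 / 2) : ℝ)) P) (hq : ∫ ω, V 0 ω ∂P = q)
    (hq0 : 0 < q) (hq1 : q ≤ 1) :
    (∀ᶠ n : ℕ in atTop, MemLp (fun ω => (average V n ω)⁻¹) 2 P) ∧
    (fun n : ℕ => (∫ ω, ((average V n ω)⁻¹ - q⁻¹) ^ 2 ∂P) - Var[V 0; P] / n / q ^ 4)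
      =o[atTop] (fun n : ℕ => 1 / (n : ℝ)) := by
  have hV (i) : AEMeasurable (V i) P := (hid i).aemeasurable_fst
  obtain ⟨C, hC⟩ := exists_integral_abs_cube_div_le hind hid hV01 hint hq
  have h0 := memLp_of_ae_mem_Ioc (hV 0) (hV01 0)
  have key : ∀ n : ℕ, 16 ≤ n → MemLp (fun ω => (average V n ω)⁻¹) 2 P ∧
      |(∫ ω, ((average V n ω)⁻¹ - q⁻¹) ^ 2 ∂P) - Var[V 0; P] / n / q ^ 4| ≤
        (2 / q ^ 4 * C) / (n * √n) := by
    intro n hn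
    obtain ⟨hi, hb⟩ := hC n hn
    have hm := aemeasurable_average hV n
    have hae := ae_average_mem_Ioc hV01 (by omega : 1 ≤ n)
    have hD2 : Integrable (fun ω => (average V n ω - q) ^ 2 / q ^ 4) P :=
      (((memLp_of_ae_mem_Ioc hm hae 2).sub (memLp_const q)).integrable_sq).div_const _
    have hle : ∀ᵐ ω ∂P, ‖((average V n ω)⁻¹ - q⁻¹) ^ 2 - (average V n ω - q) ^ 2 / q ^ 4‖ ≤
        2 / q ^ 4 * (|average V n ω - q| ^ 3 / average V n ω ^ 2) := by
      filter_upwards [hae] with ω h using abs_inv_sub_inv_sq_sub_le h hq0 hq1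
    have hR : Integrable (fun ω => ((average V n ω)⁻¹ - q⁻¹) ^ 2 -
        (average V n ω - q) ^ 2 / q ^ 4) P :=
      (hi.const_mul _).mono' (by fun_prop) hle
    have hI : Integrable (fun ω => ((average V n ω)⁻¹ - q⁻¹) ^ 2) P := by
      exact (hR.add hD2).congr (ae_of_all _ fun ω => sub_add_cancel _ _)
    have hL : MemLp (fun ω => (average V n ω)⁻¹ - q⁻¹) 2 P :=
      (memLp_two_iff_integrable_sq (by fun_prop)).2 hI
    refine ⟨(hL.add (memLp_const q⁻¹)).ae_eq (ae_of_all _ fun ω => sub_add_cancel _ _), ?_⟩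
    have e : (∫ ω, ((average V n ω)⁻¹ - q⁻¹) ^ 2 ∂P) - Var[V 0; P] / n / q ^ 4 =
        ∫ ω, (((average V n ω)⁻¹ - q⁻¹) ^ 2 - (average V n ω - q) ^ 2 / q ^ 4) ∂P := by
      rw [integral_sub hI hD2, integral_div,
        integral_average_sub_sq hind hid (h0 2) hq (by omega)]
    rw [e]
    refine (norm_integral_le_of_norm_le (hi.const_mul _) hle).trans ?_
    rw [integral_const_mul, mul_div_assoc]
    gcongr
  exact ⟨(eventually_ge_atTop 16).mono fun n hn => (key n hn).1,
    isLittleO_one_div_of_abs_le ((eventually_ge_atTop 16).mono fun n hn => (key n hn).2)⟩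

/-- The delta method for the reciprocal of an average. -/
theorem tendstoInDistribution_sqrt_mul_inv_average (hind : iIndepFun V P)
    (hid : ∀ i, IdentDistrib (V i) (V 0) P P)
    (hV01 : ∀ i, ∀ᵐ ω ∂P, V i ω ∈ Set.Ioc (0 : ℝ) 1) (hq : ∫ ω, V 0 ω ∂P = q) (hq0 : 0 < q)
    {L : ℝ} (hL : L ≠ 0) {v : ℝ≥0} (hv : (v : ℝ) = L ^ 2 * Var[V 0; P] / q ^ 4) :
    TendstoInDistribution (fun (n : ℕ) ω => √(n : ℝ) * (L * ((average V n ω)⁻¹ - q⁻¹))) atTop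
      (id : ℝ → ℝ) (fun _ => P) (gaussianReal 0 v) := by
  have hV (i) : AEMeasurable (V i) P := (hid i).aemeasurable_fst
  have h0 := memLp_of_ae_mem_Ioc (hV 0) (hV01 0)
  set c : ℝ := -(L / q ^ 2) with hc
  have hc0 : c ≠ 0 := by rw [hc]; exact neg_ne_zero.2 (div_ne_zero hL (by positivity))
  -- The limit in the central limit theorem is realised as `c⁻¹ x` under `N(0, v)`, so that
  -- multiplication by the delta-method slope `c = -L / q²` returns the identity.
  have hY : HasLaw (fun x : ℝ => c⁻¹ * id x) (gaussianReal 0 Var[V 0; P].toNNReal)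
      (gaussianReal 0 v) := by
    convert gaussianReal_const_mul (HasLaw.id (μ := gaussianReal 0 v)) c⁻¹ using 2
    · simp
    · ext
      rw [Real.coe_toNNReal _ (variance_nonneg _ _)]
      push_cast
      rw [hv, hc]
      field_simp
  have hclt := tendstoInDistribution_inv_sqrt_mul_sum_sub hY (h0 2) hind hid
  rw [hq] at hclt
  have hW : TendstoInMeasure P (fun n ω => (average V n ω)⁻¹) atTop (fun _ => q⁻¹) := by
    refine tendstoInMeasure_of_tendsto_ae
      (fun n => (aemeasurable_average hV n).inv.aestronglyMeasurable) ?_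
    filter_upwards [strong_law_ae_real V ((h0 1).integrable le_rfl)
      (fun i j hij => hind.indepFun hij) hid] with ω h
    rw [hq] at h
    exact h.inv₀ hq0.ne'
  -- Slutsky's theorem for the exact identity `L (W⁻¹ - q⁻¹) = -(L / q) (W - q) W⁻¹`, with `W⁻¹`
  -- tending to `q⁻¹`.
  have hS := hclt.continuous_comp_prodMk_of_tendstoInMeasure_const
    (g := fun p : ℝ × ℝ => -(L / q) * p.1 * p.2) (by fun_prop) hW
    fun n => (aemeasurable_average hV n).inv
  refine TendstoInDistribution.congr (fun n => ?_) (ae_of_all _ fun x => ?_) hS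
  · rcases Nat.eq_zero_or_pos n with rfl | hn
    · exact ae_of_all _ fun ω => by simp [average]
    filter_upwards [ae_average_mem_Ioc hV01 hn] with ω h
    have hn0 : (0 : ℝ) < n := by exact_mod_cast hn
    have hs : (0 : ℝ) < √n := Real.sqrt_pos.2 hn0
    have hss : √(n : ℝ) ^ 2 = n := Real.sq_sqrt hn0.le
    have e : ∑ k ∈ Finset.range n, V k ω - n * q = √n ^ 2 * (average V n ω - q) := by
      rw [hss, average]; field_simp
    have hW0 := h.1.ne'
    rw [e]
    field_simp
    ring
  · simp only [hc, id]
    field_simp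

end Averages

/-! ### Integrals against the exponential law. -/

section ExpMeasure

variable {r : ℝ}

lemma expMeasure_eq_withDensity_restrict (r : ℝ) :
    expMeasure r = (volume.restrict (Set.Ioi 0)).withDensity
      fun x => ENNReal.ofReal (r * Real.exp (-(r * x))) := by
  rw [← withDensity_indicator measurableSet_Ioi]
  refine withDensity_congr_ae ?_
  filter_upwards [Measure.ae_ne volume (0 : ℝ)] with x hx
  change exponentialPDF r x = _
  rw [exponentialPDF_eq]
  rcases lt_or_gt_of_ne hx with h | h
  · simp [h.not_ge, h.le]
  · simp [h.le, h]

lemma ae_expMeasure_pos (r : ℝ) : ∀ᵐ x ∂(expMeasure r), 0 < x := by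
  rw [expMeasure_eq_withDensity_restrict]
  exact (withDensity_absolutelyContinuous _ _).ae_le (ae_restrict_mem measurableSet_Ioi)

lemma integral_expMeasure (hr : 0 < r) (f : ℝ → ℝ) :
    ∫ x, f x ∂(expMeasure r) = ∫ x in Set.Ioi 0, r * Real.exp (-(r * x)) * f x := by
  rw [expMeasure_eq_withDensity_restrict, integral_withDensity_eq_integral_toReal_smul
    (by fun_prop) (ae_of_all _ fun x => ENNReal.ofReal_lt_top)]
  refine integral_congr_ae (ae_of_all _ fun x => ?_)
  simp only
  rw [ENNReal.toReal_ofReal (by positivity), smul_eq_mul]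

lemma integrable_expMeasure_iff (hr : 0 < r) (f : ℝ → ℝ) :
    Integrable f (expMeasure r) ↔
      IntegrableOn (fun x => r * Real.exp (-(r * x)) * f x) (Set.Ioi 0) := by
  rw [expMeasure_eq_withDensity_restrict, integrable_withDensity_iff_integrable_smul'
    (by fun_prop) (ae_of_all _ fun x => ENNReal.ofReal_lt_top)]
  refine integrable_congr (ae_of_all _ fun x => ?_)
  simp only
  rw [ENNReal.toReal_ofReal (by positivity), smul_eq_mul]

lemma integral_rpow_expMeasure (hr : 0 < r) {a : ℝ} (ha0 : 0 < a) (ha1 : a ≤ 1) :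
    ∫ x, a ^ x ∂(expMeasure r) = r / (r - Real.log a) := by
  have hl := Real.log_nonpos ha0.le ha1
  rw [integral_expMeasure hr]
  have e (x : ℝ) : r * Real.exp (-(r * x)) * a ^ x = r * Real.exp ((Real.log a - r) * x) := by
    rw [Real.rpow_def_of_pos ha0, mul_assoc, ← Real.exp_add]
    ring_nf
  simp_rw [e]
  rw [integral_const_mul, integral_exp_mul_Ioi (by linarith)]
  have : r - Real.log a ≠ 0 := by linarith
  have : Real.log a - r ≠ 0 := by linarith
  simp
  field_simp
  ring

/-- With `y = -x ln a`, the inequality `1 + y ≤ exp y` gives `1 - exp (-y) ≥ y / (1 + y)`;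
subadditivity of the square root splits `√(1 + y⁻¹)`. The singularity `x^(-1/2)` at `0` is
integrable. -/
lemma one_sub_rpow_rpow_neg_half_le {a x : ℝ} (ha0 : 0 < a) (ha1 : a < 1) (hx : 0 < x) :
    (1 - a ^ x) ^ (-(1 / 2) : ℝ) ≤ 1 + (-Real.log a) ^ (-(1 / 2) : ℝ) * x ^ (-(1 / 2) : ℝ) := by
  have hl : 0 < -Real.log a := neg_pos.2 (Real.log_neg ha0 ha1)
  set y := -Real.log a * x with hy
  have hy0 : 0 < y := by positivity
  have h1 : 1 - a ^ x = 1 - Real.exp (-y) := by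
    rw [Real.rpow_def_of_pos ha0, hy]; ring_nf
  have h2 : y / (1 + y) ≤ 1 - Real.exp (-y) := by
    have := Real.add_one_le_exp y
    rw [Real.exp_neg, div_le_iff₀ (by positivity)]
    have h3 : (Real.exp y)⁻¹ * (1 + y) ≤ 1 := by
      rw [inv_mul_le_iff₀ (Real.exp_pos y)]; linarith
    linarith
  rw [h1, ← Real.mul_rpow hl.le hx.le, ← hy]
  calc _ ≤ (y / (1 + y)) ^ (-(1 / 2) : ℝ) :=
        Real.rpow_le_rpow_of_nonpos (by positivity) h2 (by norm_num)
    _ = (1 + y⁻¹) ^ (1 / 2 : ℝ) := by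
        rw [Real.rpow_neg (by positivity), ← Real.inv_rpow (by positivity)]
        congr 1
        field_simp
        ring
    _ ≤ 1 ^ (1 / 2 : ℝ) + (y⁻¹) ^ (1 / 2 : ℝ) :=
        Real.rpow_add_le_add_rpow zero_le_one (by positivity) (by norm_num) (by norm_num)
    _ = _ := by rw [Real.one_rpow, Real.inv_rpow hy0.le, Real.rpow_neg hy0.le]

lemma integrable_one_sub_rpow_rpow_neg_half (hr : 0 < r) {a : ℝ} (ha0 : 0 < a) (ha1 : a < 1) :
    Integrable (fun x : ℝ => (1 - a ^ x) ^ (-(1 / 2) : ℝ)) (expMeasure r) := by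
  have := isProbabilityMeasure_expMeasure hr
  have h1 : Integrable (fun x : ℝ => x ^ (-(1 / 2) : ℝ)) (expMeasure r) := by
    rw [integrable_expMeasure_iff hr]
    have h := (integrableOn_rpow_mul_exp_neg_mul_rpow (p := 1) (s := -(1 / 2)) (by norm_num)
      one_pos hr).const_mul r
    refine h.congr (ae_of_all _ fun x => ?_)
    simp only [Real.rpow_one, neg_mul]
    ring
  have hm : Measurable fun x : ℝ => (1 - a ^ x) ^ (-(1 / 2) : ℝ) := by
    have : Measurable fun x : ℝ => a ^ x := measurable_const.pow measurable_id
    fun_prop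
  refine ((integrable_const 1).add (h1.const_mul ((-Real.log a) ^ (-(1 / 2) : ℝ)))).mono'
    hm.aestronglyMeasurable ?_
  filter_upwards [ae_expMeasure_pos r] with x hx
  have : a ^ x ≤ 1 := Real.rpow_le_one ha0.le ha1.le hx.le
  rw [Real.norm_of_nonneg (Real.rpow_nonneg (by linarith) _)]
  exact one_sub_rpow_rpow_neg_half_le ha0 ha1 hx

end ExpMeasure

/-! ### Taylor terms of a quotient, and the weighting function. -/

/-- The first- and second-order Taylor terms of the quotient. -/
lemma taylorTwo_div {a b h k : ℝ} (hb : b ≠ 0) :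
    taylorTwo (fun p => p.1 / p.2) (a, b) (a + h, b + k) =
      h / b - a * k / b ^ 2 + (a * k ^ 2 / b ^ 3 - h * k / b ^ 2) := by
  have hD (p : ℝ × ℝ) (hp : p.2 ≠ 0) (w : ℝ × ℝ) :
      fderiv ℝ (fun p : ℝ × ℝ => p.1 / p.2) p w = w.1 / p.2 - p.1 * w.2 / p.2 ^ 2 := by
    have := (hasFDerivAt_fst (𝕜 := ℝ) (p := p)).mul
      ((hasDerivAt_inv hp).comp_hasFDerivAt p (hasFDerivAt_snd (𝕜 := ℝ) (p := p)))
    change fderiv ℝ (fun p : ℝ × ℝ => p.1 * p.2⁻¹) p w = _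
    erw [this.fderiv]
    simp
    field_simp
    ring
  have hC : ContDiffAt ℝ 2 (fun p : ℝ × ℝ => p.1 / p.2) (a, b) :=
    contDiffAt_fst.div contDiffAt_snd hb
  have hdiff : DifferentiableAt ℝ (fderiv ℝ fun p : ℝ × ℝ => p.1 / p.2) (a, b) :=
    (hC.fderiv_right (m := 1) (by norm_num)).differentiableAt (by norm_num)
  have hDD : fderiv ℝ (fderiv ℝ fun p : ℝ × ℝ => p.1 / p.2) (a, b) (h, k) (h, k) =
      2 * (a * k ^ 2 / b ^ 3 - h * k / b ^ 2) := by
    -- Freezing the direction `(h, k)` reduces the Hessian form to the derivative of a scalar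
    -- function, known in closed form where the denominator is nonzero.
    have h1 : fderiv ℝ (fun p => fderiv ℝ (fun p : ℝ × ℝ => p.1 / p.2) p (h, k)) (a, b) (h, k) =
        fderiv ℝ (fderiv ℝ fun p : ℝ × ℝ => p.1 / p.2) (a, b) (h, k) (h, k) := by
      rw [fderiv_clm_apply hdiff (differentiableAt_const _)]
      simp
    have h2 : (fun p => fderiv ℝ (fun p : ℝ × ℝ => p.1 / p.2) p (h, k)) =ᶠ[𝓝 (a, b)]
        fun p => h / p.2 - p.1 * k / p.2 ^ 2 := by
      have : ∀ᶠ p : ℝ × ℝ in 𝓝 (a, b), p.2 ≠ 0 :=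
        continuous_snd.continuousAt.eventually_ne hb
      filter_upwards [this] with p hp using hD p hp (h, k)
    have hx := hasFDerivAt_fst (𝕜 := ℝ) (p := ((a, b) : ℝ × ℝ))
    have hy := hasFDerivAt_snd (𝕜 := ℝ) (p := ((a, b) : ℝ × ℝ))
    have h3 := (((hasDerivAt_inv hb).comp_hasFDerivAt (a, b) hy).const_mul h).sub
      ((hx.mul_const k).mul
        ((hasDerivAt_inv (pow_ne_zero 2 hb)).comp_hasFDerivAt (a, b) (hy.pow 2)))
    rw [← h1, h2.fderiv_eq]
    change fderiv ℝ (fun p : ℝ × ℝ => h * p.2⁻¹ - p.1 * k * (p.2 ^ 2)⁻¹) (a, b) (h, k) = _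
    erw [h3.fderiv]
    simp
    field_simp
    ring
  have hz : ((a + h, b + k) : ℝ × ℝ) - (a, b) = (h, k) := by simp
  rw [taylorTwo, hz, hDD, hD _ hb]
  ring

lemma deriv_weightU {u : ℝ} (hu0 : 0 < u) (x : ℝ) :
    deriv (weightU u) x = -Real.log u * (1 - weightU u x) := by
  have h : HasDerivAt (weightU u) (-(u ^ x * Real.log u)) x := by
    have := (Real.hasStrictDerivAt_const_rpow hu0 x).hasDerivAt.const_sub 1
    exact this
  rw [h.deriv, weightU]
  ring

lemma measurable_weightU (u : ℝ) : Measurable (weightU u) := by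
  have : Measurable fun x : ℝ => u ^ x := measurable_const.pow measurable_id
  exact this.const_sub 1

/-! ### Mean and variance of the weighting function. -/

section Exponential

variable {lam u : ℝ}

lemma weightU_mem_Ioc (hu0 : 0 < u) (hu1 : u < 1) {x : ℝ} (hx : 0 < x) :
    weightU u x ∈ Set.Ioc (0 : ℝ) 1 := by
  have h1 : u ^ x < 1 := Real.rpow_lt_one hu0.le hu1 hx
  have h2 : 0 < u ^ x := Real.rpow_pos_of_pos hu0 x
  exact ⟨by rw [weightU]; linarith, by rw [weightU]; linarith⟩

lemma ae_weightU_mem_Ioc (lam : ℝ) (hu0 : 0 < u) (hu1 : u < 1) :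
    ∀ᵐ x ∂(expMeasure lam), weightU u x ∈ Set.Ioc (0 : ℝ) 1 := by
  filter_upwards [ae_expMeasure_pos lam] with x hx using weightU_mem_Ioc hu0 hu1 hx

lemma memLp_weightU (hlam : 0 < lam) (hu0 : 0 < u) (hu1 : u < 1) (p : ENNReal) :
    MemLp (weightU u) p (expMeasure lam) :=
  have := isProbabilityMeasure_expMeasure hlam
  memLp_of_ae_mem_Ioc (measurable_weightU u).aemeasurable (ae_weightU_mem_Ioc lam hu0 hu1) p

lemma memLp_const_rpow (hlam : 0 < lam) (hu0 : 0 < u) (hu1 : u < 1) (p : ENNReal) :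
    MemLp (fun x : ℝ => u ^ x) p (expMeasure lam) := by
  have := isProbabilityMeasure_expMeasure hlam
  have h := (memLp_const (1 : ℝ)).sub (memLp_weightU hlam hu0 hu1 p)
  exact h.ae_eq (ae_of_all _ fun x => by simp [weightU])

lemma integral_weightU (hlam : 0 < lam) (hu0 : 0 < u) (hu1 : u < 1) :
    ∫ x, weightU u x ∂(expMeasure lam) = -Real.log u / (lam - Real.log u) := by
  have := isProbabilityMeasure_expMeasure hlam
  have hl := Real.log_neg hu0 hu1
  simp only [weightU]
  rw [integral_sub (integrable_const _) ((memLp_const_rpow hlam hu0 hu1 1).integrable le_rfl),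
    integral_rpow_expMeasure hlam hu0 hu1.le]
  have : lam - Real.log u ≠ 0 := by linarith
  simp
  field_simp
  ring

lemma integral_deriv_weightU (hlam : 0 < lam) (hu0 : 0 < u) (hu1 : u < 1) :
    ∫ x, deriv (weightU u) x ∂(expMeasure lam) = -Real.log u * lam / (lam - Real.log u) := by
  simp only [deriv_weightU hu0, weightU, sub_sub_cancel]
  rw [integral_const_mul, integral_rpow_expMeasure hlam hu0 hu1.le, mul_div_assoc]

lemma variance_weightU (hlam : 0 < lam) (hu0 : 0 < u) (hu1 : u < 1) :
    Var[weightU u; expMeasure lam] = lam * Real.log u ^ 2 /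
      ((lam - 2 * Real.log u) * (lam - Real.log u) ^ 2) := by
  have := isProbabilityMeasure_expMeasure hlam
  have hl := Real.log_neg hu0 hu1
  have hm := memLp_const_rpow hlam hu0 hu1 2
  have e (x : ℝ) : (u ^ x) ^ 2 = (u ^ 2) ^ x := by
    rw [← Real.rpow_natCast, ← Real.rpow_natCast, ← Real.rpow_mul hu0.le, ← Real.rpow_mul hu0.le,
      mul_comm]
  change Var[fun x => 1 - u ^ x; expMeasure lam] = _
  rw [variance_const_sub hm.aestronglyMeasurable, variance_eq_sub hm,
    integral_rpow_expMeasure hlam hu0 hu1.le]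
  simp only [Pi.pow_apply, e]
  rw [integral_rpow_expMeasure hlam (by positivity) (by nlinarith), Real.log_pow]
  have h1 : lam - Real.log u ≠ 0 := by linarith
  have h2 : lam - 2 * Real.log u ≠ 0 := by linarith
  push_cast
  field_simp
  ring

end Exponential

/-! ### Reduction of the estimator to a reciprocal. -/

section Estimator

variable {Ω : Type*} {lam u : ℝ} {X : ℕ → Ω → ℝ}

lemma sampleMean_deriv_weightU (hu0 : 0 < u) {n : ℕ} (hn : 1 ≤ n) (ω : Ω) :
    sampleMean (deriv (weightU u)) X n ω =
      -Real.log u * (1 - sampleMean (weightU u) X n ω) := by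
  have hn0 : (n : ℝ) ≠ 0 := by exact_mod_cast (by omega : n ≠ 0)
  simp only [sampleMean, deriv_weightU hu0]
  rw [← Finset.mul_sum, Finset.sum_sub_distrib]
  simp only [Finset.sum_const, Finset.card_range, nsmul_eq_mul]
  field_simp

lemma expEstimator_weightU_sub (hlam : 0 < lam) (hu0 : 0 < u) (hu1 : u < 1) {n : ℕ} (hn : 1 ≤ n)
    {ω : Ω} (h : sampleMean (weightU u) X n ω ≠ 0) :
    expEstimator (weightU u) X n ω - lam = -Real.log u *
      ((sampleMean (weightU u) X n ω)⁻¹ - (-Real.log u / (lam - Real.log u))⁻¹) := by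
  have hl := Real.log_neg hu0 hu1
  have h1 : lam - Real.log u ≠ 0 := by linarith
  have h2 := hl.ne
  rw [expEstimator, sampleMean_deriv_weightU hu0 hn]
  field_simp
  ring

/-- The two sample means are affinely related, so the bivariate expansion runs along a line on which
`a / b` is `-ln u (b⁻¹ - 1)`; it becomes the one-variable expansion of the reciprocal. -/
lemma expTaylorError_weightU (hlam : 0 < lam) (hu0 : 0 < u) (hu1 : u < 1) {n : ℕ} (hn : 1 ≤ n)
    {q : ℝ} (hq : q = -Real.log u / (lam - Real.log u)) (ω : Ω) :
    expTaylorError (weightU u) lam X n ω =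
      Real.log u / q ^ 2 * (sampleMean (weightU u) X n ω - q) +
        -Real.log u / q ^ 3 * (sampleMean (weightU u) X n ω - q) ^ 2 := by
  have hl := Real.log_neg hu0 hu1
  have h1 : lam - Real.log u ≠ 0 := by linarith
  have hq0 : q ≠ 0 := by rw [hq]; exact div_ne_zero (by linarith) h1
  have ha : -Real.log u * lam / (lam - Real.log u) = -Real.log u * (1 - q) := by
    rw [hq]; field_simp; ring
  rw [expTaylorError, sampleMean_deriv_weightU hu0 hn, integral_weightU hlam hu0 hu1,
    integral_deriv_weightU hlam hu0 hu1, ← hq, ha]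
  set W := sampleMean (weightU u) X n ω
  have e1 : -Real.log u * (1 - W) = -Real.log u * (1 - q) + Real.log u * (W - q) := by ring
  have e2 : taylorTwo (fun p => p.1 / p.2) (-Real.log u * (1 - q), q)
      (-Real.log u * (1 - W), W) = taylorTwo (fun p => p.1 / p.2) (-Real.log u * (1 - q), q)
      (-Real.log u * (1 - q) + Real.log u * (W - q), q + (W - q)) := by
    rw [e1, add_sub_cancel]
  rw [e2, taylorTwo_div hq0]
  field_simp
  ring

end Estimator

end SteinMM

/-! ### The main theorem. -/

theorem mainTheorem11 {Ω : Type*} [MeasurableSpace Ω] (P : Measure Ω) [IsProbabilityMeasure P]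
    (lam u : ℝ) (hlam : 0 < lam) (hu0 : 0 < u) (hu1 : u < 1)
    (X : ℕ → Ω → ℝ) (hindep : iIndepFun X P)
    (hlaw : ∀ i, HasLaw (X i) (expMeasure lam) P) :
    SteinMM.IsAsympNormal P (SteinMM.expEstimator (SteinMM.weightU u) X) lam
        (SteinMM.asympVarU lam u) ∧
    SteinMM.HasAsympBias P (SteinMM.expEstimator (SteinMM.weightU u) X) lam
        (SteinMM.asympBiasU lam u) ∧
    (∀ n : ℕ, 1 ≤ n →
      Integrable (SteinMM.expTaylorError (SteinMM.weightU u) lam X n) P ∧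
      ∫ ω, SteinMM.expTaylorError (SteinMM.weightU u) lam X n ω ∂P =
        SteinMM.asympBiasU lam u n) ∧
    (∀ n : ℕ, 1 ≤ n →
      SteinMM.asympVarU lam u n + SteinMM.asympBiasU lam u n ^ 2 = SteinMM.asympMSEU lam u n) ∧
    SteinMM.HasAsympMSE P (SteinMM.expEstimator (SteinMM.weightU u) X) lam
        (SteinMM.asympMSEU lam u) := by
  have hl := Real.log_neg hu0 hu1
  have hd1 : lam - Real.log u ≠ 0 := by linarith
  have hd2 : lam - Real.log u * 2 ≠ 0 := by linarith
  have hl0 := hl.ne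
  have hd1' : 0 < lam - Real.log u := by linarith
  have hd2' : 0 < lam - 2 * Real.log u := by linarith
  set V : ℕ → Ω → ℝ := fun i ω => SteinMM.weightU u (X i ω) with hVdef
  obtain ⟨q, hqdef⟩ : ∃ q, q = -Real.log u / (lam - Real.log u) := ⟨_, rfl⟩
  have hq0 : 0 < q := by rw [hqdef]; exact div_pos (by linarith) hd1'
  have hq1 : q ≤ 1 := by rw [hqdef, div_le_one hd1']; linarith
  have hwm := SteinMM.measurable_weightU u
  have hind : iIndepFun V P := hindep.comp (fun _ => SteinMM.weightU u) fun _ => hwm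
  have hXid (i) : IdentDistrib (X i) (X 0) P P :=
    ⟨(hlaw i).aemeasurable, (hlaw 0).aemeasurable, by rw [(hlaw i).map_eq, (hlaw 0).map_eq]⟩
  have hid (i) : IdentDistrib (V i) (V 0) P P := (hXid i).comp hwm
  have hX0 : IdentDistrib (X 0) id P (expMeasure lam) :=
    ⟨(hlaw 0).aemeasurable, aemeasurable_id, by rw [(hlaw 0).map_eq, Measure.map_id]⟩
  have hV0 : IdentDistrib (V 0) (SteinMM.weightU u) P (expMeasure lam) := hX0.comp hwm
  have hV01 (i) : ∀ᵐ ω ∂P, V i ω ∈ Set.Ioc (0 : ℝ) 1 := by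
    have h := (hXid i).trans hX0 |>.comp hwm
    exact h.symm.ae_mem_snd measurableSet_Ioc (SteinMM.ae_weightU_mem_Ioc lam hu0 hu1)
  have hint : Integrable (fun ω => V 0 ω ^ (-(1 / 2) : ℝ)) P :=
    (hV0.comp (u := fun x : ℝ => x ^ (-(1 / 2) : ℝ)) (by fun_prop)).integrable_iff.2
      (SteinMM.integrable_one_sub_rpow_rpow_neg_half hlam hu0 hu1)
  have hq : ∫ ω, V 0 ω ∂P = q := by
    rw [hV0.integral_eq, SteinMM.integral_weightU hlam hu0 hu1, hqdef]
  have hvar : Var[V 0; P] = lam * Real.log u ^ 2 /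
      ((lam - 2 * Real.log u) * (lam - Real.log u) ^ 2) := by
    rw [hV0.variance_eq, SteinMM.variance_weightU hlam hu0 hu1]
  have hVm (i) : AEMeasurable (V i) P := (hid i).aemeasurable_fst
  have hasV (n : ℕ) : (-Real.log u) ^ 2 * (Var[V 0; P] / n / q ^ 4) =
      SteinMM.asympVarU lam u n := by
    rw [SteinMM.asympVarU, hvar, hqdef]
    field_simp
  have hasB (n : ℕ) : -Real.log u * (Var[V 0; P] / n / q ^ 3) =
      SteinMM.asympBiasU lam u n := by
    rw [SteinMM.asympBiasU, SteinMM.asympVarU, hvar, hqdef]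
    field_simp
  have hMSE (n : ℕ) (hn : 1 ≤ n) : SteinMM.asympVarU lam u n + SteinMM.asympBiasU lam u n ^ 2 =
      SteinMM.asympMSEU lam u n := by
    have hn0 : (n : ℝ) ≠ 0 := by exact_mod_cast (by omega : n ≠ 0)
    rw [SteinMM.asympMSEU, SteinMM.asympBiasU, SteinMM.asympVarU]
    field_simp
  have hest (n : ℕ) (hn : 1 ≤ n) :
      (fun ω => -Real.log u * ((SteinMM.average V n ω)⁻¹ - q⁻¹)) =ᵐ[P]
        fun ω => SteinMM.expEstimator (SteinMM.weightU u) X n ω - lam := by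
    filter_upwards [SteinMM.ae_average_mem_Ioc hV01 hn] with ω h
    rw [hqdef]
    exact (SteinMM.expEstimator_weightU_sub hlam hu0 hu1 hn h.1.ne').symm
  have hest' (n : ℕ) (hn : 1 ≤ n) :
      (fun ω => -Real.log u * ((SteinMM.average V n ω)⁻¹ - q⁻¹) + lam) =ᵐ[P]
        SteinMM.expEstimator (SteinMM.weightU u) X n := by
    filter_upwards [hest n hn] with ω h
    rw [h, sub_add_cancel]
  refine ⟨?_, ⟨?_, ?_⟩, fun n hn => ?_, hMSE, ?_, ?_⟩
  · have hv0 : 0 < lam * ((lam - Real.log u) ^ 2 / (lam - 2 * Real.log u)) := by positivity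
    refine ⟨(lam * ((lam - Real.log u) ^ 2 / (lam - 2 * Real.log u))).toNNReal,
      Real.toNNReal_pos.2 hv0,
      fun n _ => ?_, ?_⟩
    · rw [SteinMM.asympVarU, Real.coe_toNNReal _ hv0.le]
      ring
    · refine (SteinMM.tendstoInDistribution_sqrt_mul_inv_average hind hid hV01 hq hq0
        (L := -Real.log u) (by linarith) ?_).congr (fun n => ?_) (ae_of_all _ fun _ => rfl)
      · rw [Real.coe_toNNReal _ hv0.le, hvar, hqdef]
        field_simp
      · rcases Nat.eq_zero_or_pos n with rfl | hn
        · exact ae_of_all _ fun ω => by simp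
        · filter_upwards [hest n hn] with ω h
          rw [h]
  · filter_upwards [(SteinMM.isLittleO_integral_inv_average hind hid hV01 hint hq hq0).1,
      eventually_ge_atTop 1] with n h hn
    exact (((h.sub (integrable_const q⁻¹)).const_mul _).add (integrable_const lam)).congr
      (hest' n hn)
  · obtain ⟨hi, ho⟩ := SteinMM.isLittleO_integral_inv_average hind hid hV01 hint hq hq0
    refine (ho.const_mul_left (-Real.log u)).congr' ?_ EventuallyEq.rfl
    filter_upwards [hi, eventually_ge_atTop 1] with n h hn
    have h1 : Integrable (fun ω => -Real.log u * ((SteinMM.average V n ω)⁻¹ - q⁻¹)) P :=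
      (h.sub (integrable_const q⁻¹)).const_mul _
    rw [← integral_congr_ae (hest' n hn), integral_add h1 (integrable_const lam), integral_const_mul,
      integral_sub h (integrable_const q⁻¹), ← hasB]
    simp
    ring
  · have hmem := SteinMM.memLp_of_ae_mem_Ioc (SteinMM.aemeasurable_average hVm n)
      (SteinMM.ae_average_mem_Ioc hV01 hn)
    have h0 := SteinMM.memLp_of_ae_mem_Ioc (hVm 0) (hV01 0)
    have i1 : Integrable (fun ω => SteinMM.average V n ω - q) P :=
      ((hmem 1).integrable le_rfl).sub (integrable_const q)
    have i2 : Integrable (fun ω => (SteinMM.average V n ω - q) ^ 2) P :=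
      ((hmem 2).sub (memLp_const q)).integrable_sq
    have e : SteinMM.expTaylorError (SteinMM.weightU u) lam X n = fun ω =>
        Real.log u / q ^ 2 * (SteinMM.average V n ω - q) +
          -Real.log u / q ^ 3 * (SteinMM.average V n ω - q) ^ 2 :=
      funext fun ω => SteinMM.expTaylorError_weightU hlam hu0 hu1 hn hqdef ω
    rw [e]
    refine ⟨(i1.const_mul _).add (i2.const_mul _), ?_⟩
    rw [integral_add (i1.const_mul _) (i2.const_mul _), integral_const_mul, integral_const_mul,
      SteinMM.integral_average_sub_sq hind hid (h0 2) hq hn,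
      integral_sub ((hmem 1).integrable le_rfl) (integrable_const q),
      SteinMM.integral_average hid ((h0 1).integrable le_rfl) hq hn, ← hasB]
    simp
    ring
  · filter_upwards [(SteinMM.isLittleO_integral_inv_average_sub_sq hind hid hV01 hint hq hq0
      hq1).1, eventually_ge_atTop 1] with n h hn
    exact (((h.sub (memLp_const q⁻¹)).const_mul _).add (memLp_const lam)).ae_eq (hest' n hn)
  · obtain ⟨-, ho⟩ :=
      SteinMM.isLittleO_integral_inv_average_sub_sq hind hid hV01 hint hq hq0 hq1
    -- The squared bias is a constant over `n²`, so the expansion with leading term `σ_n²` also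
    -- holds with `MSE_n`.
    have hB : (fun n => SteinMM.asympBiasU lam u n ^ 2) =o[atTop] fun n : ℕ => 1 / (n : ℝ) := by
      have h1 : (fun n : ℕ => 1 / (n : ℝ)) =o[atTop] fun _ => (1 : ℝ) :=
        (isLittleO_one_iff ℝ).2 tendsto_one_div_atTop_nhds_zero_nat
      have h2 := (((isBigO_refl (fun n : ℕ => 1 / (n : ℝ)) atTop).mul_isLittleO h1).const_mul_left
        ((-Real.log u * Var[V 0; P] / q ^ 3) ^ 2))
      refine h2.congr (fun n => ?_) fun n => mul_one _
      rw [← hasB]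
      ring
    refine ((ho.const_mul_left ((-Real.log u) ^ 2)).sub hB).congr' ?_ EventuallyEq.rfl
    filter_upwards [eventually_ge_atTop 1] with n hn
    have e : ∫ ω, (SteinMM.expEstimator (SteinMM.weightU u) X n ω - lam) ^ 2 ∂P =
        (-Real.log u) ^ 2 * ∫ ω, ((SteinMM.average V n ω)⁻¹ - q⁻¹) ^ 2 ∂P := by
      rw [← integral_const_mul]
      refine integral_congr_ae ?_
      filter_upwards [hest n hn] with ω h
      rw [← h, mul_pow]
    rw [e, ← hMSE n hn, ← hasV]
    ring
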